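/- For $a,b\in\mathbb R^d$ (indices modulo $d$) let $a*b$ be the circular convolution, $(a*b)_k=\sum_{j=0}^{d-1}a_jb_{k-j}$, and let $a^{\mathsf R}$ be the reversal, $(a^{\mathsf R})_i=a_{-i}$. Let $\mathrm{circCP}_d\subseteq\mathbb R^d$ be the circulant completely positive cone, that is, the convex cone generated by the vectors $v*v^{\mathsf R}$ with $v\in\mathbb R^d_+$ (entrywise nonnegative). For a convex cone $C$ and $v\neq0$, the half-line $\mathbb R_+v=\{\lambda v:\lambda\ge0\}\subseteq C$ is an extreme ray of $C$, written $\mathbb R_+v\in\operatorname{ext}C$, if $v=x+y$ with $x,y\in C$ implies $x,y\in\mathbb R_+v$. **Theorem.** For $\theta\in\mathbb R$ define $$x_\theta:=(2\cos(2\theta)+4,\;4\cos\theta,\;1,\;1,\;4\cos\theta),\qquad x'_\theta:=(2\cos(2\theta)+4,\;1,\;4\cos\theta,\;4\cos\theta,\;1).$$ The set of extreme rays of $\mathrm{circCP}_5$ is exactly $$\operatorname{ext}\mathrm{circCP}_5=\Big\{\mathbb R_+u:\ u\in\{(1,0,0,0,0),(1,1,1,1,1),(2,1,0,0,1),(2,0,1,1,0)\}\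 \sqcup\ \{x_\theta:\theta\in[0,\pi/5]\}\ \sqcup\ \{x'_\theta:\theta\in[0,\pi/5]\}\Big\},$$ where the three parts of the list are pairwise disjoint; moreover no ray is generated by vectors from two different parts. -/

import Mathlib

/-- The reversal `(vᴿ)_i = v_{(-i) mod d}`. -/
def reversal {d : ℕ} [NeZero d] (v : Fin d → ℝ) : Fin d → ℝ :=
  fun i => v (-i)

/-- The circular convolution `(a * b)_k = ∑_j a_j b_{(k - j) mod d}`. Subtraction in `Fin d` is
modulo `d`. -/
def circConv {d : ℕ} [NeZero d] (a b : Fin d → ℝ) : Fin d → ℝ :=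
  fun k => ∑ j, a j * b (k - j)

/-- The circulant completely positive cone: the convex cone generated by the vectors `v * vᴿ` for
entrywise nonnegative `v`. -/
noncomputable def circCP (d : ℕ) [NeZero d] : PointedCone ℝ (Fin d → ℝ) :=
  PointedCone.hull ℝ {a | ∃ v : Fin d → ℝ, (∀ i, 0 ≤ v i) ∧ a = circConv v (reversal v)}

/-- The half-line `ℝ₊ v = {c v : c ≥ 0}`. -/
def halfLine {V : Type*} [AddCommGroup V] [Module ℝ V] (v : V) : Set V :=
  {x | ∃ c : ℝ, 0 ≤ c ∧ x = c • v}

/-- The set of extremal rays of a convex cone `C`: the half-lines `ℝ₊ v ⊆ C`, `v ≠ 0`, such that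
`v = x + y` with `x, y ∈ C` is possible only for `x, y ∈ ℝ₊ v`. -/
def extremalRays {V : Type*} [AddCommGroup V] [Module ℝ V] (C : PointedCone ℝ V) : Set (Set V) :=
  {R | ∃ v : V, v ≠ 0 ∧ R = halfLine v ∧ halfLine v ⊆ (C : Set V) ∧
    ∀ x ∈ C, ∀ y ∈ C, v = x + y → x ∈ halfLine v ∧ y ∈ halfLine v}

/-- The vectors `x_θ`. -/
noncomputable def xVec (θ : ℝ) : Fin 5 → ℝ :=
  ![2 * Real.cos (2 * θ) + 4, 4 * Real.cos θ, 1, 1, 4 * Real.cos θ]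

/-- The vectors `x'_θ`. -/
noncomputable def xVec' (θ : ℝ) : Fin 5 → ℝ :=
  ![2 * Real.cos (2 * θ) + 4, 1, 4 * Real.cos θ, 4 * Real.cos θ, 1]

/-- The four isolated generators. -/
def isolatedVecs : Set (Fin 5 → ℝ) :=
  {![1, 0, 0, 0, 0], ![1, 1, 1, 1, 1], ![2, 1, 0, 0, 1], ![2, 0, 1, 1, 0]}

/-! Elements of the cone have the form `(p, q, r, r, q)`. Put L_t = p - t q + (t² - 2) r, with t = 2
cos θ, so that θ ∈ [0, π/5] becomes t ∈ [φ, 2]. Copositivity of the associated circulant forms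
(`hildebrand_form_nonneg`) gives L_t ≥ 0 on the cone, also with q and r exchanged. At (s² + 2, 2s,
1) the value of L_t is (s - t)². The curve is thus the envelope of the planes L_t = 0, each touching
it along a single ray. The end planes also contain (2, 1, 0) for t = 2 and (1, 1, 1) for t = φ.
Lowering p until some L_t vanishes therefore writes any point with r ≤ q as a combination of listed
vectors (`HalfIneq.exists_decomposition`), so no other ray is extreme. Conversely, inequalities
tight at a listed vector are tight on both summands of any splitting, which forces the summands onto
its ray. -/

/-! ### The facet inequalities of the cone -/

/-- The inequalities cutting out one of the two symmetric halves of `circCP 5`, in terms of the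
entries `(p, q, r, r, q)`. -/
def HalfIneq (p q r : ℝ) : Prop :=
  0 ≤ q ∧ 0 ≤ r ∧ ∀ t ∈ Set.Icc Real.goldenRatio 2, 0 ≤ p - t * q + (t ^ 2 - 2) * r

/-- The Horn and Hildebrand circulant forms are nonnegative on the nonnegative orthant, provided
two cyclically consecutive entries are increasing. -/
theorem hildebrand_form_nonneg_of_le {t a b c d e : ℝ}
    (ht : t ∈ Set.Icc Real.goldenRatio 2) (hb : 0 ≤ b) (hc : 0 ≤ c) (hd : 0 ≤ d) (hde : d ≤ e) :
    0 ≤ (a ^ 2 + b ^ 2 + c ^ 2 + d ^ 2 + e ^ 2) - t * (a * b + b * c + c * d + d * e + e * a)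
      + (t ^ 2 - 2) * (a * c + b * d + c * e + d * a + e * b) := by
  obtain ⟨h1, h2⟩ := ht
  have hφ := Real.one_lt_goldenRatio
  have hφ2 := Real.goldenRatio_sq
  have hq : 0 ≤ t ^ 2 - t - 1 := by nlinarith
  have hs : 0 ≤ 1 - t ^ 2 / 4 := by nlinarith
  have he : 0 ≤ e - (t - 1) * d := by nlinarith
  -- Complete the square in `a`. The remainder is a square, weighted using t ≤ 2, plus products
  -- weighted by t² - t - 1, which is nonnegative because t ≥ φ.
  have key : (a ^ 2 + b ^ 2 + c ^ 2 + d ^ 2 + e ^ 2) - t * (a * b + b * c + c * d + d * e + e * a)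
      + (t ^ 2 - 2) * (a * c + b * d + c * e + d * a + e * b) =
      (a - t / 2 * b + (t ^ 2 / 2 - 1) * c + (t ^ 2 / 2 - 1) * d - t / 2 * e) ^ 2
      + (1 - t ^ 2 / 4) * (b - e - t * c + t * d) ^ 2
      + (t ^ 2 - t - 1) * ((t + 2) * (b * d + c * (e - (t - 1) * d))) := by ring
  have ht2 : 0 ≤ t + 2 := by linarith
  rw [key]
  positivity

/-- The Horn and Hildebrand circulant forms are copositive. -/
theorem hildebrand_form_nonneg {t a b c d e : ℝ} (ht : t ∈ Set.Icc Real.goldenRatio 2)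
    (ha : 0 ≤ a) (hb : 0 ≤ b) (hc : 0 ≤ c) (hd : 0 ≤ d) (he : 0 ≤ e) :
    0 ≤ (a ^ 2 + b ^ 2 + c ^ 2 + d ^ 2 + e ^ 2) - t * (a * b + b * c + c * d + d * e + e * a)
      + (t ^ 2 - 2) * (a * c + b * d + c * e + d * a + e * b) := by
  -- The form is invariant under cyclic shifts, and five numbers cannot strictly decrease all the
  -- way round a cycle.
  rcases le_total d e with h | h
  · exact hildebrand_form_nonneg_of_le ht hb hc hd h
  rcases le_total e a with h' | h'
  · linarith [hildebrand_form_nonneg_of_le (a := b) ht hc hd he h']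
  rcases le_total a b with h'' | h''
  · linarith [hildebrand_form_nonneg_of_le (a := c) ht hd he ha h'']
  rcases le_total b c with h3 | h3
  · linarith [hildebrand_form_nonneg_of_le (a := d) ht he ha hb h3]
  · linarith [hildebrand_form_nonneg_of_le (a := e) ht ha hb hc (by linarith : c ≤ d)]

theorem HalfIneq.add {p q r p' q' r' : ℝ} (h : HalfIneq p q r) (h' : HalfIneq p' q' r') :
    HalfIneq (p + p') (q + q') (r + r') :=
  ⟨add_nonneg h.1 h'.1, add_nonneg h.2.1 h'.2.1,
    fun t ht => by linarith [h.2.2 t ht, h'.2.2 t ht]⟩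

theorem HalfIneq.smul {p q r c : ℝ} (hc : 0 ≤ c) (h : HalfIneq p q r) :
    HalfIneq (c * p) (c * q) (c * r) :=
  ⟨mul_nonneg hc h.1, mul_nonneg hc h.2.1,
    fun t ht => by linarith [mul_nonneg hc (h.2.2 t ht)]⟩

theorem circConv_reversal_five (v : Fin 5 → ℝ) :
    circConv v (reversal v) =
      ![v 0 ^ 2 + v 1 ^ 2 + v 2 ^ 2 + v 3 ^ 2 + v 4 ^ 2,
        v 0 * v 1 + v 1 * v 2 + v 2 * v 3 + v 3 * v 4 + v 4 * v 0,
        v 0 * v 2 + v 1 * v 3 + v 2 * v 4 + v 3 * v 0 + v 4 * v 1,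
        v 0 * v 2 + v 1 * v 3 + v 2 * v 4 + v 3 * v 0 + v 4 * v 1,
        v 0 * v 1 + v 1 * v 2 + v 2 * v 3 + v 3 * v 4 + v 4 * v 0] := by
  have e : ∀ k j : Fin 5, -(k - j) = j - k := by decide
  ext k
  simp only [circConv, reversal, Fin.sum_univ_five, e]
  fin_cases k
  · change v 0 * v 0 + v 1 * v 1 + v 2 * v 2 + v 3 * v 3 + v 4 * v 4 = _
    simp; ring
  · change v 0 * v 4 + v 1 * v 0 + v 2 * v 1 + v 3 * v 2 + v 4 * v 3 = _
    simp; ring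
  · change v 0 * v 3 + v 1 * v 4 + v 2 * v 0 + v 3 * v 1 + v 4 * v 2 = _
    simp; ring
  · change v 0 * v 2 + v 1 * v 3 + v 2 * v 4 + v 3 * v 0 + v 4 * v 1 = _
    simp
  · change v 0 * v 1 + v 1 * v 2 + v 2 * v 3 + v 3 * v 4 + v 4 * v 0 = _
    simp

/-- Every element of `circCP 5` is symmetric and satisfies all the facet inequalities. -/
theorem ineqs_of_mem_circCP {a : Fin 5 → ℝ} (ha : a ∈ circCP 5) :
    a = ![a 0, a 1, a 2, a 2, a 1] ∧ HalfIneq (a 0) (a 1) (a 2) ∧ HalfIneq (a 0) (a 2) (a 1) := by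
  suffices h : (a 3 = a 2 ∧ a 4 = a 1) ∧ HalfIneq (a 0) (a 1) (a 2) ∧
      HalfIneq (a 0) (a 2) (a 1) by
    refine ⟨?_, h.2⟩
    ext k
    fin_cases k <;> simp [h.1]
  unfold circCP PointedCone.hull at ha
  induction ha using Submodule.span_induction with
  | mem x hx =>
    obtain ⟨v, hv, rfl⟩ := hx
    have h0 := hv 0
    have h1 := hv 1
    have h2 := hv 2
    have h3 := hv 3
    have h4 := hv 4
    rw [circConv_reversal_five]
    refine ⟨⟨rfl, rfl⟩, ⟨?_, ?_, fun t ht => ?_⟩, ⟨?_, ?_, fun t ht => ?_⟩⟩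
    · simp; positivity
    · simp; positivity
    · simpa using hildebrand_form_nonneg ht h0 h1 h2 h3 h4
    · simp; positivity
    · simp; positivity
    -- The index map j ↦ 2j modulo 5 exchanges the two off-diagonal correlations.
    · have := hildebrand_form_nonneg ht h0 h2 h4 h1 h3
      simp
      linarith
  | zero => simp [HalfIneq]
  | add x y _ _ hx hy =>
    exact ⟨⟨by simp [hx.1.1, hy.1.1], by simp [hx.1.2, hy.1.2]⟩, hx.2.1.add hy.2.1,
      hx.2.2.add hy.2.2⟩
  | smul c x _ hx =>
    exact ⟨⟨by simp [hx.1.1], by simp [hx.1.2]⟩, hx.2.1.smul c.2, hx.2.2.smul c.2⟩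

/-! ### Decomposition into the listed generators -/

/-- The ratio q / r selects the boundary piece below the point: the plane t = 2 above ratio 4, the
curve between 2φ and 4, the plane t = φ below 2φ. In each case α is the slack of the corresponding
inequality L_t ≥ 0. -/
theorem HalfIneq.exists_decomposition {p q r : ℝ} (h : HalfIneq p q r) (hrq : r ≤ q) :
    ∃ α β γ δ : ℝ, ∃ t ∈ Set.Icc Real.goldenRatio 2, 0 ≤ α ∧ 0 ≤ β ∧ 0 ≤ γ ∧ 0 ≤ δ ∧
      p = α + β + 2 * γ + (t ^ 2 + 2) * δ ∧ q = β + γ + 2 * t * δ ∧ r = β + δ := by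
  obtain ⟨hq, hr, hL⟩ := h
  have hφ := Real.one_lt_goldenRatio
  have hφ2 := Real.goldenRatio_lt_two
  have hsq := Real.goldenRatio_sq
  rcases le_total (4 * r) q with h4 | h4
  · have h2 := hL 2 ⟨hφ2.le, le_rfl⟩
    exact ⟨p - 2 * q + 2 * r, 0, q - 4 * r, r, 2, ⟨hφ2.le, le_rfl⟩, by linarith, le_rfl,
      by linarith, hr, by ring, by ring, by ring⟩
  rcases le_total (2 * Real.goldenRatio * r) q with h5 | h5
  · rcases hr.eq_or_lt with rfl | hr0
    · have h2 := hL 2 ⟨hφ2.le, le_rfl⟩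
      have : q = 0 := by linarith
      subst this
      exact ⟨p, 0, 0, 0, 2, ⟨hφ2.le, le_rfl⟩, by linarith, le_rfl, le_rfl, le_rfl, by ring,
        by ring, by ring⟩
    · have ht : q / (2 * r) ∈ Set.Icc Real.goldenRatio 2 :=
        ⟨by rw [le_div_iff₀ (by positivity)]; linarith,
          by rw [div_le_iff₀ (by positivity)]; linarith⟩
      have hqt : q = 2 * (q / (2 * r)) * r := by field_simp
      have := hL _ ht
      generalize q / (2 * r) = t at *
      subst hqt
      exact ⟨p - (t ^ 2 + 2) * r, 0, 0, r, t, ht, by linarith, le_rfl, le_rfl, hr, by ring,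
        by ring, by ring⟩
  · have hL := hL _ ⟨le_rfl, hφ2.le⟩
    generalize Real.goldenRatio = φ at *
    have hpos : 0 < 2 * φ - 1 := by linarith
    have hδ : (q - r) / (2 * φ - 1) * (2 * φ - 1) = q - r := by field_simp
    have hδ0 : 0 ≤ (q - r) / (2 * φ - 1) := div_nonneg (by linarith) hpos.le
    generalize (q - r) / (2 * φ - 1) = δ at *
    obtain rfl : q = r + δ * (2 * φ - 1) := by linarith
    have hrδ : 0 ≤ r - δ := by
      by_contra hneg
      nlinarith
    refine ⟨p - (r - δ) - (φ ^ 2 + 2) * δ, r - δ, 0, δ, φ, ⟨le_rfl, hφ2.le⟩, ?_, hrδ, le_rfl,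
      hδ0, by ring, by ring, by ring⟩
    rw [hsq] at hL ⊢
    have e : p - φ * (r + δ * (2 * φ - 1)) + (φ + 1 - 2) * r =
      p - r - δ * (2 * φ ^ 2 - φ) := by ring
    rw [e, hsq] at hL
    linarith

/-! ### Faces -/

/-- On `HalfIneq`, the ray of `(t² + 2, 2t, 1)` is extreme. -/
theorem HalfIneq.eq_of_add_eq {t p q r p' q' r' : ℝ} (ht : t ∈ Set.Icc Real.goldenRatio 2)
    (h : HalfIneq p q r) (h' : HalfIneq p' q' r')
    (hp : p + p' = t ^ 2 + 2) (hq : q + q' = 2 * t) (hr : r + r' = 1) :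
    p = r * (t ^ 2 + 2) ∧ q = r * (2 * t) := by
  have hL := h.2.2 t ht
  have hL' := h'.2.2 t ht
  -- L_t vanishes at (t² + 2, 2t, 1), so it vanishes on both summands.
  have e : p - t * q + (t ^ 2 - 2) * r + (p' - t * q' + (t ^ 2 - 2) * r') = 0 := by
    obtain rfl : p' = t ^ 2 + 2 - p := by linarith
    obtain rfl : q' = 2 * t - q := by linarith
    obtain rfl : r' = 1 - r := by linarith
    ring
  have h0 : p - t * q + (t ^ 2 - 2) * r = 0 := by linarith
  have h0' : p' - t * q' + (t ^ 2 - 2) * r' = 0 := by linarith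
  suffices hD : q = r * (2 * t) by
    refine ⟨?_, hD⟩
    rw [hD] at h0
    linarith
  -- A one-sided variation of t suffices: both summands satisfy the same bound on q - 2tr, and these
  -- quantities sum to zero. Increasing t stays in the interval unless t = 2, where t is decreased
  -- instead.
  rcases ht.2.lt_or_eq with h2 | rfl
  · have up : ∀ {P Q R : ℝ}, HalfIneq P Q R → P - t * Q + (t ^ 2 - 2) * R = 0 →
        Q ≤ 2 * t * R := by
      intro P Q R H H0
      by_contra! hlt
      have hR := H.2.1
      -- This bound on ε keeps the second-order term εR below the first-order gap; R + 1 avoids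
      -- dividing by zero.
      have hpos : 0 < (Q - 2 * t * R) / (2 * (R + 1)) := by
        apply div_pos <;> linarith
      set ε := min (2 - t) ((Q - 2 * t * R) / (2 * (R + 1))) with hε
      have hε0 : 0 < ε := lt_min (by linarith) hpos
      have hε1 : ε ≤ 2 - t := min_le_left _ _
      have hε2 : ε * (2 * (R + 1)) ≤ Q - 2 * t * R := by
        rw [← le_div_iff₀ (by linarith)]
        exact min_le_right _ _
      have H1 := H.2.2 (t + ε) ⟨by linarith [ht.1], by linarith⟩
      have e1 : P - (t + ε) * Q + ((t + ε) ^ 2 - 2) * R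
        = (P - t * Q + (t ^ 2 - 2) * R) - ε * (Q - 2 * t * R - ε * R) := by ring
      rw [e1, H0] at H1
      have : 0 < ε * (Q - 2 * t * R - ε * R) := by
        apply mul_pos hε0
        nlinarith
      linarith
    have a1 := up h h0
    have a2 := up h' h0'
    obtain rfl : q' = 2 * t - q := by linarith
    obtain rfl : r' = 1 - r := by linarith
    linarith
  · have down : ∀ {P Q R : ℝ}, HalfIneq P Q R → P - 2 * Q + (2 ^ 2 - 2) * R = 0 →
        4 * R ≤ Q := by
      intro P Q R H H0
      by_contra! hlt
      have hφ2 := Real.goldenRatio_lt_two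
      have hR := H.2.1
      have hpos : 0 < (4 * R - Q) / (2 * (R + 1)) := by
        apply div_pos <;> linarith
      set ε := min (2 - Real.goldenRatio) ((4 * R - Q) / (2 * (R + 1))) with hε
      have hε0 : 0 < ε := lt_min (by linarith) hpos
      have hε1 : ε ≤ 2 - Real.goldenRatio := min_le_left _ _
      have hε2 : ε * (2 * (R + 1)) ≤ 4 * R - Q := by
        rw [← le_div_iff₀ (by linarith)]
        exact min_le_right _ _
      have H1 := H.2.2 (2 - ε) ⟨by linarith, by linarith⟩
      have e1 : P - (2 - ε) * Q + ((2 - ε) ^ 2 - 2) * R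
        = (P - 2 * Q + (2 ^ 2 - 2) * R) - ε * (4 * R - Q - ε * R) := by ring
      rw [e1, H0] at H1
      have : 0 < ε * (4 * R - Q - ε * R) := by
        apply mul_pos hε0
        nlinarith
      linarith
    have a1 := down h h0
    have a2 := down h' h0'
    linarith

/-! ### Generators -/

theorem smul_mem_circCP {c : ℝ} {a : Fin 5 → ℝ} (hc : 0 ≤ c) (ha : a ∈ circCP 5) :
    c • a ∈ circCP 5 :=
  PointedCone.smul_mem _ hc ha

theorem autocorrelation_mem_circCP {a b c d e p q r : ℝ} (ha : 0 ≤ a) (hb : 0 ≤ b) (hc : 0 ≤ c)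
    (hd : 0 ≤ d) (he : 0 ≤ e) (hp : p = a ^ 2 + b ^ 2 + c ^ 2 + d ^ 2 + e ^ 2)
    (hq : q = a * b + b * c + c * d + d * e + e * a)
    (hr : r = a * c + b * d + c * e + d * a + e * b) : ![p, q, r, r, q] ∈ circCP 5 := by
  subst hp hq hr
  refine Submodule.subset_span ⟨![a, b, c, d, e], ?_, (circConv_reversal_five ![a, b, c, d, e]).symm⟩
  intro i
  fin_cases i <;> assumption

theorem single_mem_circCP : ![1, 0, 0, 0, 0] ∈ circCP 5 := by
  apply autocorrelation_mem_circCP (a := 1) (b := 0) (c := 0) (d := 0) (e := 0) <;> norm_num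

theorem ones_mem_circCP : ![1, 1, 1, 1, 1] ∈ circCP 5 := by
  have h : ![5, 5, 5, 5, 5] ∈ circCP 5 := by
    apply autocorrelation_mem_circCP (a := 1) (b := 1) (c := 1) (d := 1) (e := 1) <;> norm_num
  simpa using smul_mem_circCP (c := 5⁻¹) (by norm_num) h

theorem adjacent_mem_circCP : ![2, 1, 0, 0, 1] ∈ circCP 5 := by
  apply autocorrelation_mem_circCP (a := 1) (b := 1) (c := 0) (d := 0) (e := 0) <;> norm_num

theorem nonadjacent_mem_circCP : ![2, 0, 1, 1, 0] ∈ circCP 5 := by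
  apply autocorrelation_mem_circCP (a := 1) (b := 0) (c := 1) (d := 0) (e := 0) <;> norm_num

theorem curve_mem_circCP {t : ℝ} (ht : 0 ≤ t) :
    ![t ^ 2 + 2, 2 * t, 1, 1, 2 * t] ∈ circCP 5 :=
  autocorrelation_mem_circCP zero_le_one ht zero_le_one le_rfl le_rfl (by ring) (by ring) (by ring)

theorem curve'_mem_circCP {t : ℝ} (ht : 0 ≤ t) :
    ![t ^ 2 + 2, 1, 2 * t, 2 * t, 1] ∈ circCP 5 :=
  autocorrelation_mem_circCP ht le_rfl zero_le_one zero_le_one le_rfl (by ring) (by ring) (by ring)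

theorem xVec_eq (θ : ℝ) :
    xVec θ = ![(2 * Real.cos θ) ^ 2 + 2, 2 * (2 * Real.cos θ), 1, 1, 2 * (2 * Real.cos θ)] := by
  have := Real.cos_two_mul θ
  ext k
  fin_cases k <;> simp [xVec, this] <;> ring

theorem xVec'_eq (θ : ℝ) :
    xVec' θ = ![(2 * Real.cos θ) ^ 2 + 2, 1, 2 * (2 * Real.cos θ), 2 * (2 * Real.cos θ), 1] := by
  have := Real.cos_two_mul θ
  ext k
  fin_cases k <;> simp [xVec', this] <;> ring

theorem two_mul_cos_pi_div_five : 2 * Real.cos (Real.pi / 5) = Real.goldenRatio := by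
  rw [Real.cos_pi_div_five, Real.goldenRatio]
  ring

theorem two_mul_cos_mem {θ : ℝ} (hθ : θ ∈ Set.Icc 0 (Real.pi / 5)) :
    2 * Real.cos θ ∈ Set.Icc Real.goldenRatio 2 := by
  have hπ := Real.pi_pos
  refine ⟨?_, by linarith [Real.cos_le_one θ]⟩
  rw [← two_mul_cos_pi_div_five]
  linarith [Real.cos_le_cos_of_nonneg_of_le_pi hθ.1 (by linarith) hθ.2]

theorem exists_two_mul_cos_eq {t : ℝ} (ht : t ∈ Set.Icc Real.goldenRatio 2) :
    ∃ θ ∈ Set.Icc 0 (Real.pi / 5), 2 * Real.cos θ = t := by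
  have hφ := Real.one_lt_goldenRatio
  have hπ := Real.pi_pos
  have hc : Real.cos (Real.arccos (t / 2)) = t / 2 :=
    Real.cos_arccos (by linarith [ht.1]) (by linarith [ht.2])
  refine ⟨Real.arccos (t / 2), ⟨Real.arccos_nonneg _, ?_⟩, by rw [hc]; ring⟩
  rw [← Real.arccos_cos (x := Real.pi / 5) (by positivity) (by linarith)]
  apply Real.arccos_le_arccos
  linarith [two_mul_cos_pi_div_five, ht.1]

/-! ### Half-lines and extreme rays -/

section HalfLine

variable {V : Type*} [AddCommGroup V] [Module ℝ V]

theorem self_mem_halfLine (v : V) : v ∈ halfLine v := ⟨1, zero_le_one, (one_smul ℝ v).symm⟩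

theorem halfLine_subset {C : PointedCone ℝ V} {v : V} (hv : v ∈ C) : halfLine v ⊆ (C : Set V) := by
  rintro _ ⟨c, hc, rfl⟩
  exact PointedCone.smul_mem C hc hv

theorem halfLine_smul {c : ℝ} (hc : 0 < c) (v : V) : halfLine (c • v) = halfLine v := by
  ext x
  constructor
  · rintro ⟨a, ha, rfl⟩
    exact ⟨a * c, by positivity, by rw [mul_smul]⟩
  · rintro ⟨a, ha, rfl⟩
    exact ⟨a / c, by positivity, by rw [smul_smul, div_mul_cancel₀ _ hc.ne']⟩

theorem halfLine_mem_extremalRays {C : PointedCone ℝ V} {v : V} (hv0 : v ≠ 0) (hv : v ∈ C)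
    (h : ∀ x ∈ C, ∀ y ∈ C, x + y = v → x ∈ halfLine v) : halfLine v ∈ extremalRays C :=
  ⟨v, hv0, rfl, halfLine_subset hv, fun x hx y hy e =>
    ⟨h x hx y hy e.symm, h y hy x hx (by rw [e, add_comm])⟩⟩

/-- A nonzero nonnegative combination spanning an extreme ray spans the ray of one of its terms. -/
theorem exists_halfLine_eq_of_sum {C : PointedCone ℝ V} {v : V} (hv0 : v ≠ 0)
    (h : ∀ x ∈ C, ∀ y ∈ C, v = x + y → x ∈ halfLine v ∧ y ∈ halfLine v)
    {n : ℕ} {c : Fin n → ℝ} {g : Fin n → V} (hc : ∀ i, 0 ≤ c i) (hg : ∀ i, g i ∈ C)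
    (hv : v = ∑ i, c i • g i) : ∃ i, halfLine v = halfLine (g i) := by
  have hcg : ∀ i, c i • g i ∈ C := fun i => halfLine_subset (hg i) ⟨c i, hc i, rfl⟩
  obtain ⟨i, -, hi⟩ : ∃ i ∈ Finset.univ, c i • g i ≠ 0 := by
    by_contra! hall
    exact hv0 (hv.trans (Finset.sum_eq_zero hall))
  -- Extremality places the nonzero term `c i • g i` on the ray of `v`, so the two rays coincide.
  obtain ⟨a, ha, e⟩ := (h _ (hcg i) (∑ j ∈ Finset.univ.erase i, c j • g j)
    (C.sum_mem fun j _ => hcg j)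
    (hv.trans (Finset.add_sum_erase _ _ (Finset.mem_univ i)).symm)).1
  have ha0 : 0 < a := ha.lt_of_ne (by rintro rfl; exact hi (by rw [e, zero_smul]))
  have hci : 0 < c i := (hc i).lt_of_ne (by intro h0; exact hi (by rw [← h0, zero_smul]))
  exact ⟨i, by rw [← halfLine_smul ha0 v, ← e, halfLine_smul hci]⟩

end HalfLine

theorem mem_extremalRays_of_generator {u : Fin 5 → ℝ}
    (hu : u ∈ isolatedVecs ∪ xVec '' Set.Icc 0 (Real.pi / 5) ∪ xVec' '' Set.Icc 0 (Real.pi / 5)) :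
    halfLine u ∈ extremalRays (circCP 5) := by
  have hφ := Real.one_lt_goldenRatio
  have hφ2 := Real.goldenRatio_lt_two
  have hφm : Real.goldenRatio ∈ Set.Icc Real.goldenRatio 2 := ⟨le_rfl, hφ2.le⟩
  have h2m : (2 : ℝ) ∈ Set.Icc Real.goldenRatio 2 := ⟨hφ2.le, le_rfl⟩
  have nz : ∀ w : Fin 5 → ℝ, w 0 ≠ 0 → w ≠ 0 := fun w hw h => hw (by rw [h]; rfl)
  rcases hu with ((rfl | rfl | rfl | rfl) | ⟨θ, hθ, rfl⟩) | ⟨θ, hθ, rfl⟩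
  · refine halfLine_mem_extremalRays (nz _ (by simp)) single_mem_circCP fun x hx y hy e => ?_
    obtain ⟨ex, hx1, hx2⟩ := ineqs_of_mem_circCP hx
    obtain ⟨-, hy1, hy2⟩ := ineqs_of_mem_circCP hy
    have e1 : x 1 + y 1 = 0 := congrFun e 1
    have e2 : x 2 + y 2 = 0 := congrFun e 2
    have q0 : x 1 = 0 := by linarith [hx1.1, hy1.1]
    have r0 : x 2 = 0 := by linarith [hx2.1, hy2.1]
    have p0 : 0 ≤ x 0 := by simpa [q0, r0] using hx1.2.2 2 h2m
    refine ⟨x 0, p0, ?_⟩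
    rw [ex]
    simp [q0, r0]
  · refine halfLine_mem_extremalRays (nz _ (by simp)) ones_mem_circCP fun x hx y hy e => ?_
    obtain ⟨ex, hx1, hx2⟩ := ineqs_of_mem_circCP hx
    obtain ⟨-, hy1, hy2⟩ := ineqs_of_mem_circCP hy
    have e0 : x 0 + y 0 = 1 := congrFun e 0
    have e1 : x 1 + y 1 = 1 := congrFun e 1
    have e2 : x 2 + y 2 = 1 := congrFun e 2
    have a1 := hx1.2.2 _ hφm
    have a2 := hx2.2.2 _ hφm
    have b1 := hy1.2.2 _ hφm
    have b2 := hy2.2.2 _ hφm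
    have hsq := Real.goldenRatio_sq
    have y0 : y 0 = 1 - x 0 := by linarith
    have y1 : y 1 = 1 - x 1 := by linarith
    have y2 : y 2 = 1 - x 2 := by linarith
    rw [y0, y1, y2] at b1 b2
    rw [hsq] at a1 a2 b1 b2
    generalize Real.goldenRatio = φ at *
    -- Both inequalities at t = φ are tight at the all-ones vector; the two planes meet only in its
    -- line.
    have c1 : x 0 - φ * x 1 + (φ + 1 - 2) * x 2 = 0 := by linarith
    have c2 : x 0 - φ * x 2 + (φ + 1 - 2) * x 1 = 0 := by linarith
    have d : (2 * φ - 1) * (x 1 - x 2) = 0 := by linarith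
    have qr : x 1 = x 2 := by
      rcases mul_eq_zero.mp d with h | h <;> linarith
    have pq : x 0 = x 2 := by
      rw [qr] at c1
      linarith
    refine ⟨x 2, hx1.2.1, ?_⟩
    rw [ex]
    simp [qr, pq]
  · refine halfLine_mem_extremalRays (nz _ (by simp)) adjacent_mem_circCP fun x hx y hy e => ?_
    obtain ⟨ex, hx1, hx2⟩ := ineqs_of_mem_circCP hx
    obtain ⟨-, hy1, hy2⟩ := ineqs_of_mem_circCP hy
    have e0 : x 0 + y 0 = 2 := congrFun e 0
    have e1 : x 1 + y 1 = 1 := congrFun e 1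
    have e2 : x 2 + y 2 = 0 := congrFun e 2
    have r0 : x 2 = 0 := by linarith [hx2.1, hy2.1]
    have p0 : x 0 = x 1 * 2 := by linarith [hx1.2.2 2 h2m, hy1.2.2 2 h2m]
    refine ⟨x 1, hx1.1, ?_⟩
    rw [ex]
    simp [r0, p0]
  · refine halfLine_mem_extremalRays (nz _ (by simp)) nonadjacent_mem_circCP fun x hx y hy e => ?_
    obtain ⟨ex, hx1, hx2⟩ := ineqs_of_mem_circCP hx
    obtain ⟨-, hy1, hy2⟩ := ineqs_of_mem_circCP hy
    have e0 : x 0 + y 0 = 2 := congrFun e 0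
    have e1 : x 1 + y 1 = 0 := congrFun e 1
    have e2 : x 2 + y 2 = 1 := congrFun e 2
    have q0 : x 1 = 0 := by linarith [hx1.1, hy1.1]
    have p0 : x 0 = x 2 * 2 := by linarith [hx2.2.2 2 h2m, hy2.2.2 2 h2m]
    refine ⟨x 2, hx2.1, ?_⟩
    rw [ex]
    simp [q0, p0]
  · have ht := two_mul_cos_mem hθ
    rw [xVec_eq]
    generalize 2 * Real.cos θ = t at *
    refine halfLine_mem_extremalRays (nz _ (by simp; positivity))
      (curve_mem_circCP (by linarith [ht.1])) fun x hx y hy e => ?_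
    obtain ⟨ex, hx1, -⟩ := ineqs_of_mem_circCP hx
    obtain ⟨-, hy1, -⟩ := ineqs_of_mem_circCP hy
    obtain ⟨p0, q0⟩ := hx1.eq_of_add_eq ht hy1 (congrFun e 0) (congrFun e 1) (congrFun e 2)
    refine ⟨x 2, hx1.2.1, ?_⟩
    rw [ex]
    simp [p0, q0]
  · have ht := two_mul_cos_mem hθ
    rw [xVec'_eq]
    generalize 2 * Real.cos θ = t at *
    refine halfLine_mem_extremalRays (nz _ (by simp; positivity))
      (curve'_mem_circCP (by linarith [ht.1])) fun x hx y hy e => ?_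
    obtain ⟨ex, -, hx2⟩ := ineqs_of_mem_circCP hx
    obtain ⟨-, -, hy2⟩ := ineqs_of_mem_circCP hy
    obtain ⟨p0, q0⟩ := hx2.eq_of_add_eq ht hy2 (congrFun e 0) (congrFun e 2) (congrFun e 1)
    refine ⟨x 1, hx2.2.1, ?_⟩
    rw [ex]
    simp [p0, q0]

theorem exists_generator_of_mem_extremalRays {R : Set (Fin 5 → ℝ)}
    (hR : R ∈ extremalRays (circCP 5)) :
    R ∈ halfLine '' (isolatedVecs ∪ xVec '' Set.Icc 0 (Real.pi / 5) ∪
      xVec' '' Set.Icc 0 (Real.pi / 5)) := by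
  obtain ⟨v, hv0, rfl, hvC, hext⟩ := hR
  obtain ⟨ev, h1, h2⟩ := ineqs_of_mem_circCP (hvC (self_mem_halfLine v))
  have hφ := Real.one_lt_goldenRatio
  rcases le_total (v 2) (v 1) with h | h
  · obtain ⟨α, β, γ, δ, t, ht, hα, hβ, hγ, hδ, ep, eq, er⟩ := h1.exists_decomposition h
    obtain ⟨i, hi⟩ := exists_halfLine_eq_of_sum hv0 hext (n := 4) (c := ![α, β, γ, δ])
      (g := ![![1, 0, 0, 0, 0], ![1, 1, 1, 1, 1], ![2, 1, 0, 0, 1],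
        ![t ^ 2 + 2, 2 * t, 1, 1, 2 * t]])
      (by intro i; fin_cases i <;> assumption)
      (by
        intro i
        fin_cases i
        exacts [single_mem_circCP, ones_mem_circCP, adjacent_mem_circCP,
          curve_mem_circCP (by linarith [ht.1])])
      (by
        rw [ev, ep, eq, er]
        ext k
        fin_cases k <;> simp [Fin.sum_univ_four] <;> ring)
    rw [hi]
    apply Set.mem_image_of_mem
    fin_cases i
    · exact Or.inl (Or.inl (by simp [isolatedVecs]))
    · exact Or.inl (Or.inl (by simp [isolatedVecs]))
    · exact Or.inl (Or.inl (by simp [isolatedVecs]))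
    · obtain ⟨θ, hθ, rfl⟩ := exists_two_mul_cos_eq ht
      exact Or.inl (Or.inr ⟨θ, hθ, xVec_eq θ⟩)
  · obtain ⟨α, β, γ, δ, t, ht, hα, hβ, hγ, hδ, ep, eq, er⟩ := h2.exists_decomposition h
    obtain ⟨i, hi⟩ := exists_halfLine_eq_of_sum hv0 hext (n := 4) (c := ![α, β, γ, δ])
      (g := ![![1, 0, 0, 0, 0], ![1, 1, 1, 1, 1], ![2, 0, 1, 1, 0],
        ![t ^ 2 + 2, 1, 2 * t, 2 * t, 1]])
      (by intro i; fin_cases i <;> assumption)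
      (by
        intro i
        fin_cases i
        exacts [single_mem_circCP, ones_mem_circCP, nonadjacent_mem_circCP,
          curve'_mem_circCP (by linarith [ht.1])])
      (by
        rw [ev, ep, eq, er]
        ext k
        fin_cases k <;> simp [Fin.sum_univ_four] <;> ring)
    rw [hi]
    apply Set.mem_image_of_mem
    fin_cases i
    · exact Or.inl (Or.inl (by simp [isolatedVecs]))
    · exact Or.inl (Or.inl (by simp [isolatedVecs]))
    · exact Or.inl (Or.inl (by simp [isolatedVecs]))
    · obtain ⟨θ, hθ, rfl⟩ := exists_two_mul_cos_eq ht
      exact Or.inr ⟨θ, hθ, xVec'_eq θ⟩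

/-! ### Disjointness of the three families -/

theorem disjoint_halfLine_image {V : Type*} [AddCommGroup V] [Module ℝ V] {S T : Set V}
    (h : ∀ u ∈ S, ∀ w ∈ T, ∀ c : ℝ, u ≠ c • w) : Disjoint (halfLine '' S) (halfLine '' T) := by
  rw [Set.disjoint_left]
  rintro _ ⟨u, hu, rfl⟩ ⟨w, hw, e⟩
  obtain ⟨c, -, hc⟩ : u ∈ halfLine w := e ▸ self_mem_halfLine u
  exact h u hu w hw c hc

/-- A zero entry forces c = 0, contradicting the first entry; for the all-ones vector, 2t ≠ 1
separates the two middle values. -/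
theorem isolatedVecs_ne_smul_curve {t c : ℝ} (ht : 1 < t) {u : Fin 5 → ℝ} (hu : u ∈ isolatedVecs) :
    u ≠ c • ![t ^ 2 + 2, 2 * t, 1, 1, 2 * t] ∧ u ≠ c • ![t ^ 2 + 2, 1, 2 * t, 2 * t, 1] := by
  constructor <;> intro e <;> have e0 := congrFun e 0 <;> have e1 := congrFun e 1 <;>
    have e2 := congrFun e 2 <;> rcases hu with rfl | rfl | rfl | rfl <;> simp at e0 e1 e2 <;>
    (try subst e1) <;> (try subst e2) <;> simp at * <;> linarith

theorem mainTheorem3 :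
    extremalRays (circCP 5) =
      halfLine '' (isolatedVecs ∪ xVec '' Set.Icc 0 (Real.pi / 5) ∪
        xVec' '' Set.Icc 0 (Real.pi / 5)) ∧
    -- the three parts of the list are pairwise disjoint, even as sets of rays
    Disjoint (halfLine '' isolatedVecs) (halfLine '' (xVec '' Set.Icc 0 (Real.pi / 5))) ∧
    Disjoint (halfLine '' isolatedVecs) (halfLine '' (xVec' '' Set.Icc 0 (Real.pi / 5))) ∧
    Disjoint (halfLine '' (xVec '' Set.Icc 0 (Real.pi / 5)))
      (halfLine '' (xVec' '' Set.Icc 0 (Real.pi / 5))) := by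
  have hφ := Real.one_lt_goldenRatio
  refine ⟨Set.Subset.antisymm (fun R hR => exists_generator_of_mem_extremalRays hR) ?_,
    disjoint_halfLine_image ?_, disjoint_halfLine_image ?_, disjoint_halfLine_image ?_⟩
  · rintro _ ⟨u, hu, rfl⟩
    exact mem_extremalRays_of_generator hu
  · rintro u hu _ ⟨θ, hθ, rfl⟩ c
    rw [xVec_eq]
    exact (isolatedVecs_ne_smul_curve (by linarith [(two_mul_cos_mem hθ).1]) hu).1
  · rintro u hu _ ⟨θ, hθ, rfl⟩ c
    rw [xVec'_eq]
    exact (isolatedVecs_ne_smul_curve (by linarith [(two_mul_cos_mem hθ).1]) hu).2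
  · rintro _ ⟨θ, hθ, rfl⟩ _ ⟨θ', hθ', rfl⟩ c e
    have ht := (two_mul_cos_mem hθ).1
    have ht' := (two_mul_cos_mem hθ').1
    rw [xVec_eq, xVec'_eq] at e
    have e1 : 2 * (2 * Real.cos θ) = c * 1 := congrFun e 1
    have e2 : 1 = c * (2 * (2 * Real.cos θ')) := congrFun e 2
    -- With t = 2 cos θ and t' = 2 cos θ', eliminating c gives 4tt' = 1, impossible as t, t' > 1.
    nlinarith
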